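/- **Setting.** Let $\mathcal C$ be a site with a final object $X$ and let $G$ be a finite group. An *abelian gerbe* over $\mathcal C$ is a stack in groupoids $\mathcal Y\to\mathcal C$ that locally has objects, in which any two objects over the same $U$ are locally isomorphic, and whose objects have abelian automorphism groups. It is *banded* by an abelian sheaf $A$ if it comes with group isomorphisms $A(U)\cong\mathrm{Aut}(x)$ for all $U$ and all $x\in\mathcal Y_U$, compatible with all morphisms of $\mathcal Y$ (that is, with conjugation by isomorphisms and with restriction). A *morphism* of gerbes is a functor over $\mathcal C$, and a *2-morphism* is a base preserving natural transformation (automatically invertible). A morphism $F:\mathcal Y_1\to\mathcal Y_2$ of gerbes banded by $A_1$ and $A_2$ induces a unique homomorphism $\delta_F:A_1\to A_2$ such that $F:\mathrm{Aut}(x)\to\mathrm{Aut}(F(x))$ becomes $\delta_F:A_1(U)\to A_2(U)$ for all $x\in\mathcal Y_{1,U}$. Every 2-automorphism of such an $F$ acts on all the objects $F(x)$ through one section in $A_2(X)$, and is identified with this section. An *action* of $G$ on a gerbe $\mathcal Y$ banded by $A$ is a family of morphisms $F_g:\mathcal Y\to\mathcal Y$ $(g\in G)$ such that $\delta_{F_1}=\mathrm{id}_A$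 and such that $F_{gh}$ and $F_g\circ F_h$ are 2-isomorphic for all $g,h\in G$. Then $g\mapsto\delta_{F_g}$ is an action of $G$ on $A$, and $A(X)$ is a $G$-module. *Connecting 2-morphisms* are a choice $\alpha$ of 2-morphisms $\alpha_{g,h}:F_{gh}\to F_g\circ F_h$ for all $g,h\in G$. The 3-cochain $\kappa_{(F,\alpha)}$ of $G$ with values in $A(X)$ is defined by $$(\mathrm{id}_{F_{g_1}}\star\alpha_{g_2,g_3})\circ\alpha_{g_1,g_2g_3}=(\alpha_{g_1,g_2}\star\mathrm{id}_{F_{g_3}})\circ\alpha_{g_1g_2,g_3}\circ\kappa_{(F,\alpha)}(g_1,g_2,g_3).$$ The obstruction class $\kappa_F\in H^3(G,A(X))$ is the class of $\kappa_{(F,\alpha)}$ for any choice of $\alpha$. If $G$ acts on $\mathcal Y_1$ by $\{F^1_g\}$ and on $\mathcal Y_2$ by $\{F^2_g\}$, then a morphism of gerbes $F:\mathcal Y_1\to\mathcal Y_2$ is *$G$-equivariant* if $F\circ F^1_g$ and $F^2_g\circ F$ are 2-isomorphic for all $g\in G$; then $\delta_F$ is $G$-equivariant. **Proposition 4.18.**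 Let $\mathcal Y_1$ and $\mathcal Y_2$ be gerbes banded by $A_1$ and $A_2$, with actions of $G$ given by $\{F^1_g\}$ and $\{F^2_g\}$, and let $F:\mathcal Y_1\to\mathcal Y_2$ be a $G$-equivariant morphism of gerbes. Then $$\kappa_{F^2}=\delta_F\circ\kappa_{F^1}\quad\text{in } H^3(G,A_2(X)).$$ More precisely: for all choices of connecting 2-morphisms $\alpha^1$ and $\alpha^2$ for the two actions, $\kappa_{(F^1,\alpha^1)}$ and $\kappa_{(F^2,\alpha^2)}$ are cocycles, and the map $H^3(G,A_1(X))\to H^3(G,A_2(X))$ induced by $\delta_F$ sends the class of the first to the class of the second. Consequently (Corollary 4.19), if $\{F_g\}$ and $\{F'_g\}$ are two actions of $G$ on the same gerbe $\mathcal Y$ banded by $A$ such that $F_g$ and $F'_g$ are 2-isomorphic for all $g\in G$, then they induce the same action of $G$ on $A$, and $\kappa_F=\kappa_{F'}$ in $H^3(G,A(X))$. -/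

import Mathlib

open CategoryTheory Opposite

universe w v u v₁ u₁ v₂ u₂ v₃ u₃

namespace TorsorsAndGerbes

section Fibers

variable {C : Type u} [Category.{v} C]

/-- The object `F x` of the fibre of `𝒵` over `U`, for `x` in the fibre of `𝒴` over `U`. -/
def fiberObj {𝒴 : BasedCategory.{v₁, u₁} C} {𝒵 : BasedCategory.{v₂, u₂} C} (F : 𝒴 ⥤ᵇ 𝒵)
    {U : C} (x : 𝒴.p.Fiber U) : 𝒵.p.Fiber U :=
  ⟨F.obj x.1, (F.w_obj x.1).trans x.2⟩

/-- The morphism `F φ` of the fibre of `𝒵` over `U`, for `φ` in the fibre of `𝒴` over `U`. -/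
def fiberMap {𝒴 : BasedCategory.{v₁, u₁} C} {𝒵 : BasedCategory.{v₂, u₂} C} (F : 𝒴 ⥤ᵇ 𝒵)
    {U : C} {x y : 𝒴.p.Fiber U} (φ : x ⟶ y) : fiberObj F x ⟶ fiberObj F y :=
  ⟨F.map φ.1, by have := φ.2; exact F.preserves_isHomLift (𝟙 U) φ.1⟩

/-- The functor that `F` induces between the fibres over `U`. -/
def fiberFunctor {𝒴 : BasedCategory.{v₁, u₁} C} {𝒵 : BasedCategory.{v₂, u₂} C} (F : 𝒴 ⥤ᵇ 𝒵)
    (U : C) : 𝒴.p.Fiber U ⥤ 𝒵.p.Fiber U where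
  obj x := fiberObj F x
  map φ := fiberMap F φ
  map_id x := Subtype.ext (F.map_id x.1)
  map_comp φ ψ := Subtype.ext (F.map_comp φ.1 ψ.1)

/-- The component at `x`, in the fibre over `U`, of a base preserving natural transformation. -/
def fiberApp {𝒴 : BasedCategory.{v₁, u₁} C} {𝒵 : BasedCategory.{v₂, u₂} C} {F F' : 𝒴 ⥤ᵇ 𝒵}
    (α : F ⟶ F') {U : C} (x : 𝒴.p.Fiber U) : fiberObj F x ⟶ fiberObj F' x :=
  ⟨α.toNatTrans.app x.1, BasedNatTrans.isHomLift α x.2⟩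

/-- The isomorphism in the fibre over `U` that is the component at `x` of a 2-isomorphism. -/
def fiberAppIso {𝒴 : BasedCategory.{v₁, u₁} C} {𝒵 : BasedCategory.{v₂, u₂} C} {F F' : 𝒴 ⥤ᵇ 𝒵}
    (α : F ≅ F') {U : C} (x : 𝒴.p.Fiber U) : fiberObj F x ≅ fiberObj F' x where
  hom := fiberApp α.hom x
  inv := fiberApp α.inv x
  hom_inv_id := Subtype.ext
    (congrArg (fun β : BasedNatTrans F F => β.toNatTrans.app x.1) α.hom_inv_id)
  inv_hom_id := Subtype.ext
    (congrArg (fun β : BasedNatTrans F' F' => β.toNatTrans.app x.1) α.inv_hom_id)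

/-- The 2-isomorphism `α ⋆ id_F`, for `α` between morphisms out of the target of `F`. -/
def whiskerLeftIso {𝒳 : BasedCategory.{v₁, u₁} C} {𝒴 : BasedCategory.{v₂, u₂} C}
    {𝒵 : BasedCategory.{v₃, u₃} C} (F : 𝒳 ⥤ᵇ 𝒴) {H H' : 𝒴 ⥤ᵇ 𝒵} (α : H ≅ H') :
    F.comp H ≅ F.comp H' where
  hom := BasedCategory.whiskerLeft F α.hom
  inv := BasedCategory.whiskerLeft F α.inv
  hom_inv_id := congrArg (BasedCategory.whiskerLeft F) α.hom_inv_id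
  inv_hom_id := congrArg (BasedCategory.whiskerLeft F) α.inv_hom_id

/-- The 2-isomorphism `id_H ⋆ α`, for `α` between morphisms into the source of `H`. -/
def whiskerRightIso {𝒳 : BasedCategory.{v₁, u₁} C} {𝒴 : BasedCategory.{v₂, u₂} C}
    {𝒵 : BasedCategory.{v₃, u₃} C} {F F' : 𝒳 ⥤ᵇ 𝒴} (α : F ≅ F') (H : 𝒴 ⥤ᵇ 𝒵) :
    F.comp H ≅ F'.comp H where
  hom := BasedCategory.whiskerRight α.hom H
  inv := BasedCategory.whiskerRight α.inv H
  hom_inv_id := BasedNatTrans.homCategory.ext _ _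
    ((Functor.whiskeringRight _ _ _).obj H.toFunctor |>.mapIso
      ((BasedNatTrans.forgetful 𝒳 𝒴).mapIso α)).hom_inv_id
  inv_hom_id := BasedNatTrans.homCategory.ext _ _
    ((Functor.whiskeringRight _ _ _).obj H.toFunctor |>.mapIso
      ((BasedNatTrans.forgetful 𝒳 𝒴).mapIso α)).inv_hom_id

end Fibers

section Gerbes

variable {C : Type u} [Category.{v} C]

/-- A sieve `R` on `U`, seen as a full subcategory of `C/U`, included into `C/U`. -/
def sieveInclusion {U : C} (R : Sieve U) :
    BasedCategory.ofFunctor R.arrows.diagram ⥤ᵇ BasedCategory.ofFunctor (Over.forget U) where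
  toFunctor := ObjectProperty.ι (fun f : Over U => R.arrows f.hom)
  w := rfl

/-- For a sieve `R` on `U`, the functor `Hom_C(C/U, 𝒴) ⥤ Hom_C(R, 𝒴)` that restricts functors
over `C` and base preserving natural transformations from `C/U` to `R`. If `𝒴` is fibred in
groupoids, then the source is equivalent to the fibre of `𝒴` over `U` (by the Yoneda lemma) and
the target is equivalent to the category of descent data in `𝒴` relative to `R`. -/
def restrictToSieve (𝒴 : BasedCategory.{v₁, u₁} C) {U : C} (R : Sieve U) :
    (BasedCategory.ofFunctor (Over.forget U) ⥤ᵇ 𝒴) ⥤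
      (BasedCategory.ofFunctor R.arrows.diagram ⥤ᵇ 𝒴) where
  obj D := (sieveInclusion R).comp D
  map α := BasedCategory.whiskerLeft (sieveInclusion R) α
  map_id _ := rfl
  map_comp _ _ := rfl

/-- `𝒴` is a stack in groupoids over the site `(C, J)`: it is fibred in groupoids, and for every
covering sieve `R` of `U`, descent data relative to `R` (and their morphisms) descend uniquely
to the fibre over `U`. -/
structure IsStackInGroupoids (J : GrothendieckTopology C) (𝒴 : BasedCategory.{v₁, u₁} C) :
    Prop where
  isFibered : 𝒴.p.IsFibered
  isGroupoid (U : C) : IsGroupoid (𝒴.p.Fiber U)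
  descent (U : C) (R : Sieve U) : R ∈ J U → (restrictToSieve 𝒴 R).IsEquivalence

/-- An abelian gerbe over the site `(C, J)`. That `x` and `y` become isomorphic after pullback
along `f : V ⟶ U` is expressed by choosing any pullbacks `x'` and `y'` of `x` and `y` along `f`
(all morphisms of a category fibred in groupoids are cartesian). -/
structure IsAbelianGerbe (J : GrothendieckTopology C) (𝒴 : BasedCategory.{v₁, u₁} C) :
    Prop where
  isStack : IsStackInGroupoids J 𝒴
  locally_isomorphic (U : C) (x y : 𝒴.p.Fiber U) : ∃ R ∈ J U, ∀ ⦃V : C⦄ (f : V ⟶ U), R f →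
    ∃ (x' y' : 𝒴.p.Fiber V) (φ : x'.1 ⟶ x.1) (ψ : y'.1 ⟶ y.1),
      𝒴.p.IsHomLift f φ ∧ 𝒴.p.IsHomLift f ψ ∧ Nonempty (x' ≅ y')
  aut_comm (U : C) (x : 𝒴.p.Fiber U) (α β : Aut x) : α * β = β * α
  locally_nonempty (U : C) : ∃ R ∈ J U, ∀ ⦃V : C⦄ (f : V ⟶ U), R f → Nonempty (𝒴.p.Fiber V)

/-- A gerbe banded by the abelian sheaf `A`: an abelian gerbe together with isomorphisms of
groups `A(U) ≃ Aut(x)` for all `U` and all `x` in the fibre over `U`, which are compatible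
with all the morphisms `φ : y ⟶ x` of the gerbe. For `φ` in a fibre this is the compatibility
with conjugation by `φ`; for `φ` a pullback along `f : V ⟶ U` it says that
the isomorphisms `A(U) ≃ Aut(x)` and `A(V) ≃ Aut(y)` commute with restriction along `f`. -/
structure BandedGerbe {J : GrothendieckTopology C} (A : Sheaf J AddCommGrpCat.{w}) extends
    BasedCategory.{v₁, u₁} C where
  isAbelianGerbe : IsAbelianGerbe J toBasedCategory
  band {U : C} (x : p.Fiber U) : A.obj.obj (op U) ≃+ Additive (Aut x)
  band_naturality {U V : C} (f : V ⟶ U) (x : p.Fiber U) (y : p.Fiber V) (φ : y.1 ⟶ x.1)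
    (hφ : p.IsHomLift f φ) (a : A.obj.obj (op U)) :
    (band y (A.obj.map f.op a)).toMul.hom.1 ≫ φ = φ ≫ (band x a).toMul.hom.1

end Gerbes

section Lemmas

variable {C : Type u} [Category.{v} C] {J : GrothendieckTopology C}

theorem IsStackInGroupoids.isStronglyCartesian {𝒴 : BasedCategory.{v₁, u₁} C}
    (h : IsStackInGroupoids J 𝒴) {R S : C} (f : R ⟶ S) {a b : 𝒴.obj} (φ : a ⟶ b)
    [𝒴.p.IsHomLift f φ] : 𝒴.p.IsStronglyCartesian f φ := by
  have := h.isFibered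
  have hb : 𝒴.p.obj b = S := IsHomLift.codomain_eq 𝒴.p f φ
  let ψ := Functor.IsPreFibered.pullbackMap hb f
  let χ := Functor.IsCartesian.map 𝒴.p f ψ φ
  have hχ : χ ≫ ψ = φ := Functor.IsCartesian.fac 𝒴.p f ψ φ
  have := h.isGroupoid R
  have h1 : IsIso (Functor.Fiber.homMk 𝒴.p R χ) := inferInstance
  have h2 : IsIso χ := by
    have : IsIso (Functor.Fiber.fiberInclusion.map (Functor.Fiber.homMk 𝒴.p R χ)) := inferInstance
    exact this
  have h3 : 𝒴.p.IsStronglyCartesian (𝟙 R ≫ f) (χ ≫ ψ) := inferInstance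
  rwa [hχ, Category.id_comp] at h3

theorem isSheaf_forget (A : Sheaf J AddCommGrpCat.{w}) :
    Presieve.IsSheaf J (A.obj ⋙ forget AddCommGrpCat.{w}) :=
  Presieve.isSheaf_iso J (Functor.isoWhiskerLeft A.obj AddCommGrpCat.coyonedaObjIsoForget)
    (A.property _)

/-- Two sections of `A` that agree on a cover are equal. -/
theorem section_ext (A : Sheaf J AddCommGrpCat.{w}) {U : C} (R : Sieve U) (hR : R ∈ J U)
    (a b : A.obj.obj (op U)) (h : ∀ ⦃V : C⦄ (f : V ⟶ U), R f →
      A.obj.map f.op a = A.obj.map f.op b) :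
    a = b :=
  ((isSheaf_forget A).isSeparated R hR).ext (fun _ f hf => h f hf)

variable {A : Sheaf J AddCommGrpCat.{w}}

theorem map_map {U V W : C} (f : V ⟶ U) (g : W ⟶ V) (a : A.obj.obj (op U)) :
    A.obj.map g.op (A.obj.map f.op a) = A.obj.map (g ≫ f).op a := by
  rw [op_comp, A.obj.map_comp]; rfl

theorem map_id' {U : C} (a : A.obj.obj (op U)) : A.obj.map (𝟙 U).op a = a := by
  rw [op_id, A.obj.map_id]; rfl

/-- Sections of `A` that are attached to the objects of an abelian gerbe over `C/U`, compatibly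
with the morphisms of the gerbe, come from a unique section of `A` over `U`. -/
theorem existsUnique_section {𝒴 : BasedCategory.{v₁, u₁} C} (h : IsAbelianGerbe J 𝒴) (U : C)
    (s : ∀ {V : C} (_ : V ⟶ U) (_ : 𝒴.p.Fiber V), A.obj.obj (op V))
    (hs : ∀ {V W : C} (f : V ⟶ U) (g : W ⟶ V) (x : 𝒴.p.Fiber V) (y : 𝒴.p.Fiber W)
      (φ : y.1 ⟶ x.1), 𝒴.p.IsHomLift g φ → A.obj.map g.op (s f x) = s (g ≫ f) y) :
    ∃! t : A.obj.obj (op U), ∀ {V : C} (f : V ⟶ U) (x : 𝒴.p.Fiber V),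
      A.obj.map f.op t = s f x := by
  have := h.isStack.isFibered
  have indep : ∀ {V : C} (f : V ⟶ U) (x y : 𝒴.p.Fiber V), s f x = s f y := by
    intro V f x y
    obtain ⟨R, hR, H⟩ := h.locally_isomorphic V x y
    refine section_ext A R hR _ _ fun W g hg => ?_
    obtain ⟨x', y', φ, ψ, hφ, hψ, ⟨e⟩⟩ := H g hg
    rw [hs f g x x' φ hφ]
    refine (hs f g y x' (e.hom.1 ≫ ψ) ?_).symm
    have := e.hom.2
    have h' : 𝒴.p.IsHomLift (𝟙 W ≫ g) (e.hom.1 ≫ ψ) := inferInstance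
    rwa [Category.id_comp] at h'
  have pull : ∀ {V W : C} (g : W ⟶ V) (x : 𝒴.p.Fiber V), ∃ (y : 𝒴.p.Fiber W)
      (φ : y.1 ⟶ x.1), 𝒴.p.IsHomLift g φ := fun {V W} g x =>
    ⟨⟨_, Functor.IsPreFibered.pullbackObj_proj x.2 g⟩, Functor.IsPreFibered.pullbackMap x.2 g,
      inferInstance⟩
  let S : Sieve U :=
    { arrows := fun V _ => Nonempty (𝒴.p.Fiber V)
      downward_closed := by
        rintro V W f ⟨x⟩ g
        obtain ⟨y, -⟩ := pull g x
        exact ⟨y⟩ }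
  have hS : S ∈ J U := by
    obtain ⟨R, hR, H⟩ := h.locally_nonempty U
    exact J.superset_covering (fun V f hf => H f hf) hR
  let fam : Presieve.FamilyOfElements (A.obj ⋙ forget AddCommGrpCat.{w}) (S : Presieve U) :=
    fun V f hf => s f (Classical.choice hf)
  have hfam : fam.Compatible := by
    rw [Presieve.compatible_iff_sieveCompatible]
    intro V W f g hf
    obtain ⟨y, φ, hφ⟩ := pull g (Classical.choice hf)
    exact (indep _ _ y).trans (hs f g _ y φ hφ).symm
  obtain ⟨t, ht, htu⟩ := isSheaf_forget A S hS fam hfam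
  refine ⟨t, fun {V} f x => (ht f ⟨x⟩).trans (indep _ _ _), fun t' ht' => ?_⟩
  exact htu t' fun V f hf => ht' f _

namespace BandedGerbe

variable (𝒴 : BandedGerbe.{w, v, u, v₁, u₁} A)

/-- Vertical morphisms of a gerbe are determined by their composition with any morphism. -/
theorem vertical_ext {U V : C} (f : V ⟶ U) {x y : 𝒴.p.Fiber V} {z : 𝒴.p.Fiber U}
    (φ : y.1 ⟶ z.1) (hφ : 𝒴.p.IsHomLift f φ) (β γ : x ⟶ y) (h : β.1 ≫ φ = γ.1 ≫ φ) :
    β = γ := by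
  have := 𝒴.isAbelianGerbe.isStack.isStronglyCartesian f φ
  have h1 := β.2
  have h2 := γ.2
  exact Subtype.ext (Functor.IsStronglyCartesian.ext 𝒴.p f φ (𝟙 V) h)

/-- Compatible automorphisms of the objects of the form `F x` correspond to compatible sections
of the band. -/
theorem map_band_symm {𝒳 : BasedCategory.{v₂, u₂} C} (F : 𝒳 ⥤ᵇ 𝒴.toBasedCategory) {V W : C}
    (g : W ⟶ V) (x : 𝒳.p.Fiber V) (y : 𝒳.p.Fiber W) (φ : y.1 ⟶ x.1) (hφ : 𝒳.p.IsHomLift g φ)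
    (β : Aut (fiberObj F x)) (γ : Aut (fiberObj F y))
    (h : γ.hom.1 ≫ F.map φ = F.map φ ≫ β.hom.1) :
    A.obj.map g.op ((𝒴.band (fiberObj F x)).symm (Additive.ofMul β)) =
      (𝒴.band (fiberObj F y)).symm (Additive.ofMul γ) := by
  rw [AddEquiv.eq_symm_apply]
  apply Additive.toMul.injective
  apply Iso.ext
  have hF : 𝒴.p.IsHomLift g (F.map φ) := F.preserves_isHomLift g φ
  refine 𝒴.vertical_ext g (z := fiberObj F x) (F.map φ) hF _ _ ?_
  have := 𝒴.band_naturality g (fiberObj F x) (fiberObj F y) (F.map φ) hF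
    ((𝒴.band (fiberObj F x)).symm (Additive.ofMul β))
  rw [AddEquiv.apply_symm_apply] at this
  exact this.trans h.symm

end BandedGerbe

end Lemmas

section BandMap

variable {C : Type u} [Category.{v} C] {J : GrothendieckTopology C}
  {A₁ A₂ A₃ : Sheaf J AddCommGrpCat.{w}}
  {𝒴₁ : BandedGerbe.{w, v, u, v₁, u₁} A₁} {𝒴₂ : BandedGerbe.{w, v, u, v₂, u₂} A₂}
  {𝒴₃ : BandedGerbe.{w, v, u, v₃, u₃} A₃}

/-- `δ : A₁ ⟶ A₂` is the map that the morphism of gerbes `F` induces on the bands: under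
the identifications `A₁(U) ≃ Aut(x)` and `A₂(U) ≃ Aut(F x)`, it is `α ↦ F α`. -/
def IsBandMap (F : 𝒴₁.toBasedCategory ⥤ᵇ 𝒴₂.toBasedCategory) (δ : A₁ ⟶ A₂) : Prop :=
  ∀ ⦃U : C⦄ (x : 𝒴₁.p.Fiber U) (a : A₁.obj.obj (op U)),
    (fiberFunctor F U).mapIso (𝒴₁.band x a).toMul =
      (𝒴₂.band (fiberObj F x) (δ.hom.app (op U) a)).toMul

theorem existsUnique_isBandMap (F : 𝒴₁.toBasedCategory ⥤ᵇ 𝒴₂.toBasedCategory) :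
    ∃! δ : A₁ ⟶ A₂, IsBandMap F δ := by
  let s (U : C) (a : A₁.obj.obj (op U)) {V : C} (f : V ⟶ U) (x : 𝒴₁.p.Fiber V) :
      A₂.obj.obj (op V) := (𝒴₂.band (fiberObj F x)).symm
    (Additive.ofMul ((fiberFunctor F V).mapIso (𝒴₁.band x (A₁.obj.map f.op a)).toMul))
  have key : ∀ (U : C) (a : A₁.obj.obj (op U)), ∃! t : A₂.obj.obj (op U), ∀ {V : C} (f : V ⟶ U)
      (x : 𝒴₁.p.Fiber V), A₂.obj.map f.op t = s U a f x := by
    intro U a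
    refine existsUnique_section 𝒴₁.isAbelianGerbe U (s U a) ?_
    intro V W f g x y φ hφ
    refine 𝒴₂.map_band_symm F g x y φ hφ _ _ ?_
    have := 𝒴₁.band_naturality g x y φ hφ (A₁.obj.map f.op a)
    rw [map_map] at this
    have := congrArg F.map this
    rw [F.map_comp, F.map_comp] at this
    exact this
  choose t ht htu using key
  have hadd : ∀ (U : C) (a b : A₁.obj.obj (op U)), t U (a + b) = t U a + t U b := by
    intro U a b
    refine (htu U (a + b) _ fun {V} f x => ?_).symm
    rw [map_add, ht, ht, ← map_add]
    congr 1
    rw [map_add, map_add]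
    exact ((Functor.mapAut x (fiberFunctor F V)).map_mul _ _).symm
  have hmap : ∀ {U V : C} (f : V ⟶ U) (a : A₁.obj.obj (op U)),
      A₂.obj.map f.op (t U a) = t V (A₁.obj.map f.op a) := by
    intro U V f a
    refine htu V _ _ fun {W} g x => ?_
    rw [map_map, ht]
    change s U a (g ≫ f) x = s V _ g x
    simp only [s, map_map]
  refine ⟨ObjectProperty.homMk
    { app := fun U => AddCommGrpCat.ofHom (AddMonoidHom.mk' (t U.unop) (hadd U.unop))
      naturality := fun U V f => by
        ext a
        exact (hmap f.unop a).symm }, ?_, ?_⟩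
  · intro U x a
    have := ht U a (𝟙 U) x
    rw [map_id'] at this
    change _ = (𝒴₂.band (fiberObj F x) (t U a)).toMul
    rw [this]
    simp only [s]
    rw [AddEquiv.apply_symm_apply, map_id']
    rfl
  · intro δ hδ
    apply ObjectProperty.hom_ext
    ext U a
    refine htu U.unop a _ fun {V} f x => ?_
    simp only [s]
    rw [AddEquiv.eq_symm_apply, hδ x]
    have h := ConcreteCategory.congr_hom (δ.hom.naturality f.op) a
    exact congrArg (𝒴₂.band (fiberObj F x)) h.symm

/-- The map of sheaves of groups that a morphism of banded gerbes induces on the bands. -/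
noncomputable def bandMap (F : 𝒴₁.toBasedCategory ⥤ᵇ 𝒴₂.toBasedCategory) : A₁ ⟶ A₂ :=
  (existsUnique_isBandMap F).choose

theorem isBandMap_bandMap (F : 𝒴₁.toBasedCategory ⥤ᵇ 𝒴₂.toBasedCategory) :
    IsBandMap F (bandMap F) :=
  (existsUnique_isBandMap F).choose_spec.1

theorem IsBandMap.bandMap_eq {F : 𝒴₁.toBasedCategory ⥤ᵇ 𝒴₂.toBasedCategory} {δ : A₁ ⟶ A₂}
    (h : IsBandMap F δ) : bandMap F = δ :=
  ((existsUnique_isBandMap F).choose_spec.2 δ h).symm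

theorem bandMap_comp (F : 𝒴₁.toBasedCategory ⥤ᵇ 𝒴₂.toBasedCategory)
    (F' : 𝒴₂.toBasedCategory ⥤ᵇ 𝒴₃.toBasedCategory) :
    bandMap (𝒴₁ := 𝒴₁) (𝒴₂ := 𝒴₃) (F.comp F') = bandMap F ≫ bandMap F' := by
  refine IsBandMap.bandMap_eq fun U x a => ?_
  have h1 := congrArg (fiberFunctor F' U).mapIso (isBandMap_bandMap F x a)
  exact h1.trans (isBandMap_bandMap F' (fiberObj F x) ((bandMap F).hom.app (op U) a))

theorem bandMap_congr {F F' : 𝒴₁.toBasedCategory ⥤ᵇ 𝒴₂.toBasedCategory} (e : F ≅ F') :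
    bandMap F = bandMap F' := by
  refine (IsBandMap.bandMap_eq (δ := bandMap F) fun U x a => ?_).symm
  set b : A₂.obj.obj (op U) := (bandMap F).hom.app (op U) a with hb
  have h1 := congrArg (fun β : Aut (fiberObj F x) => β.hom) (isBandMap_bandMap F x a)
  have h2 : fiberMap F (𝒴₁.band x a).toMul.hom ≫ fiberApp e.hom x =
      fiberApp e.hom x ≫ fiberMap F' (𝒴₁.band x a).toMul.hom :=
    Subtype.ext (e.hom.toNatTrans.naturality (𝒴₁.band x a).toMul.hom.1)
  have h3 : (𝒴₂.band (fiberObj F x) b).toMul.hom ≫ fiberApp e.hom x =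
      fiberApp e.hom x ≫ (𝒴₂.band (fiberObj F' x) b).toMul.hom := by
    have := 𝒴₂.band_naturality (𝟙 U) (fiberObj F' x) (fiberObj F x) (fiberApp e.hom x).1
      (fiberApp e.hom x).2 b
    rw [map_id'] at this
    exact Subtype.ext this
  have h4 : fiberMap F (𝒴₁.band x a).toMul.hom = (𝒴₂.band (fiberObj F x) b).toMul.hom := h1
  rw [h4] at h2
  have h5 := h2.symm.trans h3
  have : IsIso (fiberApp e.hom x) := (fiberAppIso e x).isIso_hom
  exact Iso.ext ((cancel_epi (fiberApp e.hom x)).1 h5)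

theorem existsUnique_sectionOfAut {X : C} (hX : Limits.IsTerminal X)
    {F : 𝒴₁.toBasedCategory ⥤ᵇ 𝒴₂.toBasedCategory} (α : F ≅ F) :
    ∃! a : A₂.obj.obj (op X), ∀ ⦃U : C⦄ (x : 𝒴₁.p.Fiber U),
      (𝒴₂.band (fiberObj F x) (A₂.obj.map (hX.from U).op a)).toMul = fiberAppIso α x := by
  obtain ⟨a, ha, hu⟩ := existsUnique_section (A := A₂) 𝒴₁.isAbelianGerbe X
    (fun {V} _ x => (𝒴₂.band (fiberObj F x)).symm (Additive.ofMul (fiberAppIso α x)))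
    (fun {V W} f g x y φ hφ => 𝒴₂.map_band_symm F g x y φ hφ _ _
      (α.hom.toNatTrans.naturality φ).symm)
  refine ⟨a, fun U x => ?_, fun b hb => hu b fun {V} f x => ?_⟩
  · rw [ha, AddEquiv.apply_symm_apply]; rfl
  · rw [AddEquiv.eq_symm_apply, hX.hom_ext f (hX.from V)]
    exact hb x

/-- The global section of the band of `𝒴₂` that corresponds to the 2-automorphism `α` of
a morphism of gerbes `F : 𝒴₁ ⟶ 𝒴₂`: the section through which `α` acts on all objects `F x`. -/
noncomputable def sectionOfAut {X : C} (hX : Limits.IsTerminal X)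
    {F : 𝒴₁.toBasedCategory ⥤ᵇ 𝒴₂.toBasedCategory} (α : F ≅ F) : A₂.obj.obj (op X) :=
  (existsUnique_sectionOfAut hX α).choose

end BandMap

section Actions

variable {C : Type u} [Category.{v} C] {J : GrothendieckTopology C}
  {A : Sheaf J AddCommGrpCat.{w}}

/-- An action of the group `G` on a banded gerbe `𝒴`: a morphism `F_g : 𝒴 ⟶ 𝒴` for every `g`,
such that `F_1` is equivariant for the identity of the band, and such that
`F_{gh}` and `F_g ∘ F_h` are 2-isomorphic for all `g` and `h`. -/
structure GerbeAction (G : Type w) [Group G] (𝒴 : BandedGerbe.{w, v, u, v₁, u₁} A) where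
  toFun : G → (𝒴.toBasedCategory ⥤ᵇ 𝒴.toBasedCategory)
  one_equivariant : bandMap (toFun 1) = 𝟙 A
  mul_iso (g h : G) : Nonempty (toFun (g * h) ≅ (toFun h).comp (toFun g))

namespace GerbeAction

variable {G : Type w} [Group G] {𝒴 : BandedGerbe.{w, v, u, v₁, u₁} A} (𝓕 : GerbeAction G 𝒴)

/-- The underlying action of `G` on the sheaf `A`, restricted to the sections over `X`:
the element `g` acts on `A` through the map that `F_g` induces on the band. -/
noncomputable def representation (X : C) :
    Representation (ULift.{w} ℤ) G (A.obj.obj (op X)) where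
  toFun g :=
    { toFun := (bandMap (𝓕.toFun g)).hom.app (op X)
      map_add' := map_add _
      map_smul' := fun n a => map_zsmul _ n.down a }
  map_one' := by
    rw [𝓕.one_equivariant]; rfl
  map_mul' g h := by
    rw [bandMap_congr (𝓕.mul_iso g h).some, bandMap_comp]; rfl

/-- The `G`-module `A(X)`. -/
noncomputable abbrev rep (X : C) : Rep.{w} (ULift.{w} ℤ) G := Rep.of (𝓕.representation X)

/-- A choice of connecting 2-morphisms `α_{g,h} : F_{gh} ⟶ F_g ∘ F_h`; as all 2-morphisms of
gerbes are invertible, they are taken to be 2-isomorphisms. -/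
abbrev Connecting : Type _ :=
  ∀ g h : G, 𝓕.toFun (g * h) ≅ (𝓕.toFun h).comp (𝓕.toFun g)

variable {𝓕}

/-- The 2-automorphism of `F_{g₁g₂g₃}` that is the difference between the two 2-morphisms
`(id ⋆ α_{g₂,g₃}) ∘ α_{g₁,g₂g₃}` and `(α_{g₁,g₂} ⋆ id) ∘ α_{g₁g₂,g₃}` from `F_{g₁g₂g₃}` to
`F_{g₁} ∘ F_{g₂} ∘ F_{g₃}`: the inverse of the second one after the first one. -/
def difference (α : 𝓕.Connecting) (g₁ g₂ g₃ : G) :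
    𝓕.toFun (g₁ * g₂ * g₃) ≅ 𝓕.toFun (g₁ * g₂ * g₃) :=
  (eqToIso (congrArg 𝓕.toFun (mul_assoc g₁ g₂ g₃)) ≪≫ α g₁ (g₂ * g₃) ≪≫
    whiskerRightIso (α g₂ g₃) (𝓕.toFun g₁)) ≪≫
  (α (g₁ * g₂) g₃ ≪≫ whiskerLeftIso (𝓕.toFun g₃) (α g₁ g₂)).symm

/-- The 3-cochain `κ` with values in `A(X)`. -/
noncomputable def obstructionCochain {X : C} (hX : Limits.IsTerminal X) (α : 𝓕.Connecting) :
    (Fin 3 → G) → 𝓕.rep X :=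
  fun g => sectionOfAut (𝒴₁ := 𝒴) (𝒴₂ := 𝒴) hX (difference α (g 0) (g 1) (g 2))

/-- The class in `H³(G, A(X))` of the cochain `κ`, once `κ` is known to be a cocycle. -/
noncomputable def obstructionClass {X : C} (hX : Limits.IsTerminal X) (α : 𝓕.Connecting)
    (h : inhomogeneousCochains.d (𝓕.rep X) 3 (obstructionCochain hX α) = 0) :
    groupCohomology (𝓕.rep X) 3 :=
  groupCohomology.π (𝓕.rep X) 3 (groupCohomology.cocyclesMk (obstructionCochain hX α) h)

end GerbeAction

variable {A₁ A₂ : Sheaf J AddCommGrpCat.{w}} {G : Type w} [Group G]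
  {𝒴₁ : BandedGerbe.{w, v, u, v₁, u₁} A₁} {𝒴₂ : BandedGerbe.{w, v, u, v₂, u₂} A₂}

/-- A morphism of gerbes `F` is `G`-equivariant if `F ∘ F¹_g` and `F²_g ∘ F` are 2-isomorphic
for all `g`. -/
def IsEquivariant (𝓕₁ : GerbeAction G 𝒴₁) (𝓕₂ : GerbeAction G 𝒴₂)
    (F : 𝒴₁.toBasedCategory ⥤ᵇ 𝒴₂.toBasedCategory) : Prop :=
  ∀ g : G, Nonempty ((𝓕₁.toFun g).comp F ≅ F.comp (𝓕₂.toFun g))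

/-- The homomorphism of `G`-modules `A₁(X) ⟶ A₂(X)` given by the map that a `G`-equivariant
morphism of gerbes induces on the bands. -/
noncomputable def IsEquivariant.repHom {𝓕₁ : GerbeAction G 𝒴₁} {𝓕₂ : GerbeAction G 𝒴₂}
    {F : 𝒴₁.toBasedCategory ⥤ᵇ 𝒴₂.toBasedCategory} (hF : IsEquivariant 𝓕₁ 𝓕₂ F) (X : C) :
    𝓕₁.rep X ⟶ 𝓕₂.rep X :=
  Rep.ofHom
    { toFun := (bandMap F).hom.app (op X)
      map_add' := map_add _
      map_smul' := fun n a => map_zsmul _ n.down a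
      isIntertwining' := fun g => by
        ext a
        have h := bandMap_congr (𝒴₁ := 𝒴₁) (𝒴₂ := 𝒴₂) (hF g).some
        rw [bandMap_comp (𝒴₁ := 𝒴₁) (𝒴₂ := 𝒴₁) (𝒴₃ := 𝒴₂),
          bandMap_comp (𝒴₁ := 𝒴₁) (𝒴₂ := 𝒴₂) (𝒴₃ := 𝒴₂)] at h
        exact congrArg (fun δ : A₁ ⟶ A₂ => δ.hom.app (op X) a) h }

end Actions

end TorsorsAndGerbes

namespace TorsorsAndGerbes

/-! ### Global sections of the band acting on all objects -/

section Scalars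

/-! A global section `a` of the band acts on every object of the gerbe, and this action commutes
with all morphisms (`scalar_naturality`). A morphism of gerbes carries the action of `a` to that of
its image under the band map (`map_scalar`), and a section is determined by its action on the
objects `F x` (`scalar_injective`). Hence parallel 2-isomorphisms differ by a unique section of the
band over `X`, and an identity between such sections can be proved by pasting diagrams of
components, through which scalars move freely.

The cocycle identity is the pentagon: the 2-morphisms from `F_{g₁g₂g₃g₄}` to
`F_{g₁}F_{g₂}F_{g₃}F_{g₄}` obtained from the five bracketings are compared in two ways
(`obstructionCochain_cocycle`).

For the comparison, choose 2-isomorphisms `e_g` from `F ∘ F¹_g` to `F²_g ∘ F`. The two ways of going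
from `F ∘ F¹_{gh}` to `F²_g ∘ F²_h ∘ F` differ by a section `c(g,h)`. Pasting these squares for a
triple product gives `δ_F κ¹ - κ² = dc` (`obstructionCochain_comparison`), so the classes agree. The
corollary is the case where `F` is the identity. -/

theorem trans_symm_hom_comp {D : Type*} [Category* D] {a b c : D} (i : a ≅ b) (j : c ≅ b) :
    (i ≪≫ j.symm).hom ≫ j.hom = i.hom := by
  simp

variable {C : Type u} [Category.{v} C] {J : GrothendieckTopology C}
  {A A₁ A₂ : Sheaf J AddCommGrpCat.{w}} {X : C} (hX : Limits.IsTerminal X)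

/-- The automorphism through which a global section of the band acts on an object of the gerbe. -/
def scalar (𝒴 : BandedGerbe.{w, v, u, v₁, u₁} A) (a : A.obj.obj (op X)) (z : 𝒴.obj) : z ⟶ z :=
  (𝒴.band (⟨z, rfl⟩ : 𝒴.p.Fiber (𝒴.p.obj z)) (A.obj.map (hX.from _).op a)).toMul.hom.1

variable {𝒴 : BandedGerbe.{w, v, u, v₁, u₁} A}
  {𝒴₁ : BandedGerbe.{w, v, u, v₁, u₁} A₁} {𝒴₂ : BandedGerbe.{w, v, u, v₂, u₂} A₂}

/-- `scalar` uses the tautological fibre of an object. An object such as `fiberObj F x` lies over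
`U` only by a propositional equality, so the change of fibre is made here once. -/
theorem scalar_fiber (a : A.obj.obj (op X)) {U : C} (x : 𝒴.p.Fiber U) :
    scalar hX 𝒴 a x.1 = (𝒴.band x (A.obj.map (hX.from U).op a)).toMul.hom.1 := by
  obtain ⟨z, rfl⟩ := x
  rfl

/-- Here `φ` need not be vertical: as `X` is terminal, the restrictions of a global section along
any morphism of the base match. -/
theorem scalar_naturality (a : A.obj.obj (op X)) {y z : 𝒴.obj} (φ : y ⟶ z) :
    scalar hX 𝒴 a y ≫ φ = φ ≫ scalar hX 𝒴 a z := by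
  have h := 𝒴.band_naturality (𝒴.p.map φ) ⟨z, rfl⟩ ⟨y, rfl⟩ φ inferInstance
    (A.obj.map (hX.from _).op a)
  rw [map_map, hX.hom_ext (𝒴.p.map φ ≫ hX.from (𝒴.p.obj z)) (hX.from _)] at h
  exact h

theorem scalar_naturality_assoc (a : A.obj.obj (op X)) {y z t : 𝒴.obj} (φ : y ⟶ z) (ψ : z ⟶ t) :
    scalar hX 𝒴 a y ≫ φ ≫ ψ = φ ≫ scalar hX 𝒴 a z ≫ ψ := by
  rw [← Category.assoc, scalar_naturality, Category.assoc]

theorem scalar_add (a b : A.obj.obj (op X)) (z : 𝒴.obj) :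
    scalar hX 𝒴 (a + b) z = scalar hX 𝒴 a z ≫ scalar hX 𝒴 b z := by
  have h : ∀ x : 𝒴.p.Fiber (𝒴.p.obj z),
      (𝒴.band x (A.obj.map (hX.from _).op (a + b))).toMul.hom.1 =
      (𝒴.band x (A.obj.map (hX.from _).op a)).toMul.hom.1 ≫
        (𝒴.band x (A.obj.map (hX.from _).op b)).toMul.hom.1 := by
    intro x
    -- Multiplication in `Aut` is composition in the reverse order, hence the swap.
    rw [add_comm, map_add, map_add]
    rfl
  exact h ⟨z, rfl⟩

/-- This combines the defining property of the band map over the base of `z` with its naturality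
under restriction from `X`. -/
theorem map_scalar (F : 𝒴₁.toBasedCategory ⥤ᵇ 𝒴₂.toBasedCategory) (a : A₁.obj.obj (op X))
    (z : 𝒴₁.obj) :
    F.map (scalar hX 𝒴₁ a z) =
      scalar hX 𝒴₂ ((bandMap F).hom.app (op X) a) (F.obj z) := by
  let x : 𝒴₁.p.Fiber (𝒴₁.p.obj z) := ⟨z, rfl⟩
  have h := congrArg (fun β : Aut (fiberObj F x) => β.hom.1)
    (isBandMap_bandMap F x (A₁.obj.map (hX.from _).op a))
  have h' := ConcreteCategory.congr_hom ((bandMap F).hom.naturality (hX.from (𝒴₁.p.obj z)).op) a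
  refine h.trans ?_
  refine Eq.trans ?_ (scalar_fiber hX _ (fiberObj F x)).symm
  exact congrArg (fun b => (𝒴₂.band (fiberObj F x) b).toMul.hom.1) h'

theorem scalar_sectionOfAut {F : 𝒴₁.toBasedCategory ⥤ᵇ 𝒴₂.toBasedCategory} (α : F ≅ F)
    (x : 𝒴₁.obj) :
    scalar hX 𝒴₂ (sectionOfAut hX α) (F.obj x) = α.hom.toNatTrans.app x := by
  have h := (existsUnique_sectionOfAut hX α).choose_spec.1 (⟨x, rfl⟩ : 𝒴₁.p.Fiber (𝒴₁.p.obj x))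
  exact (scalar_fiber hX _ (fiberObj F _)).trans
    (congrArg (fun β : Aut (fiberObj F (⟨x, rfl⟩ : 𝒴₁.p.Fiber (𝒴₁.p.obj x))) => β.hom.1) h)

/-- Global sections of the band are determined by their action on the objects `F x`. -/
theorem scalar_injective (F : 𝒴₁.toBasedCategory ⥤ᵇ 𝒴₂.toBasedCategory)
    {a b : A₂.obj.obj (op X)}
    (h : ∀ x : 𝒴₁.obj, scalar hX 𝒴₂ a (F.obj x) = scalar hX 𝒴₂ b (F.obj x)) : a = b := by
  have h' : ∀ ⦃U : C⦄ (x : 𝒴₁.p.Fiber U), A₂.obj.map (hX.from U).op a =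
      A₂.obj.map (hX.from U).op b := by
    intro U x
    refine (𝒴₂.band (fiberObj F x)).injective (Additive.toMul.injective (Iso.ext
      (Subtype.ext ?_)))
    rw [← scalar_fiber, ← scalar_fiber]
    exact h x.1
  -- The gerbe may have no object over `X`, so the sections are compared on a cover over which it
  -- has objects.
  obtain ⟨R, hR, H⟩ := 𝒴₁.isAbelianGerbe.locally_nonempty X
  refine section_ext A₂ R hR a b fun V f hf => ?_
  obtain ⟨x⟩ := H f hf
  rw [hX.hom_ext f (hX.from V)]
  exact h' x

/-- Two parallel 2-isomorphisms differ by a global section of the band. -/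
theorem exists_scalar {F F' : 𝒴₁.toBasedCategory ⥤ᵇ 𝒴₂.toBasedCategory} (β γ : F ≅ F') :
    ∃ a : A₂.obj.obj (op X), ∀ x : 𝒴₁.obj,
      scalar hX 𝒴₂ a (F.obj x) ≫ β.hom.toNatTrans.app x = γ.hom.toNatTrans.app x := by
  refine ⟨sectionOfAut hX (γ ≪≫ β.symm), fun x => ?_⟩
  rw [scalar_sectionOfAut]
  exact congrArg (fun δ : BasedNatTrans F F' => δ.toNatTrans.app x)
    (trans_symm_hom_comp γ β)

end Scalars

/-! ### The pentagon and the cocycle identity -/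

section Cocycle

variable {C : Type u} [Category.{v} C] {J : GrothendieckTopology C}
  {A : Sheaf J AddCommGrpCat.{w}} {X : C} (hX : Limits.IsTerminal X)
  {G : Type w} [Group G] {𝒴 : BandedGerbe.{w, v, u, v₁, u₁} A} {𝓕 : GerbeAction G 𝒴}

namespace GerbeAction

/-- The component at `x` of the connecting 2-morphism `F_k ⟶ F_g ∘ F_h`, where `k = gh`. -/
def connectingApp (α : 𝓕.Connecting) {g h k : G} (hk : k = g * h) (x : 𝒴.obj) :
    (𝓕.toFun k).obj x ⟶ (𝓕.toFun g).obj ((𝓕.toFun h).obj x) :=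
  eqToHom (by rw [hk]) ≫ (α g h).hom.toNatTrans.app x

theorem connectingApp_rfl (α : 𝓕.Connecting) (g h : G) (x : 𝒴.obj) :
    connectingApp α (rfl : g * h = g * h) x = (α g h).hom.toNatTrans.app x :=
  Category.id_comp _

theorem isIso_connectingApp (α : 𝓕.Connecting) {g h k : G} (hk : k = g * h) (x : 𝒴.obj) :
    IsIso (connectingApp α hk x) := by
  subst hk
  rw [connectingApp_rfl]
  exact (((BasedNatTrans.forgetful _ _).mapIso (α g h)).app x).isIso_hom

theorem connectingApp_naturality (α : 𝓕.Connecting) {g h k : G} (hk : k = g * h) {x y : 𝒴.obj}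
    (φ : x ⟶ y) :
    (𝓕.toFun k).map φ ≫ connectingApp α hk y =
      connectingApp α hk x ≫ (𝓕.toFun g).map ((𝓕.toFun h).map φ) := by
  subst hk
  rw [connectingApp_rfl, connectingApp_rfl]
  exact (α g h).hom.toNatTrans.naturality φ

theorem eqToIso_hom_app {F F' : 𝒴.toBasedCategory ⥤ᵇ 𝒴.toBasedCategory} (h : F = F')
    (x : 𝒴.obj) : (eqToIso h).hom.toNatTrans.app x = eqToHom (by rw [h]) := by
  subst h
  rfl

/-- The defining equation of `κ`, evaluated at `x`. The products are free variables with equations,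
so that any bracketing can be used without transport along associativity. -/
theorem scalar_obstructionCochain (α : 𝓕.Connecting) {g₁ g₂ g₃ g₁₂ g₂₃ g₁₂₃ : G}
    (h₁₂ : g₁₂ = g₁ * g₂) (h₂₃ : g₂₃ = g₂ * g₃) (h : g₁₂₃ = g₁₂ * g₃) (h' : g₁₂₃ = g₁ * g₂₃)
    (x : 𝒴.obj) :
    scalar hX 𝒴 (obstructionCochain hX α ![g₁, g₂, g₃]) ((𝓕.toFun g₁₂₃).obj x) ≫
      connectingApp α h x ≫ connectingApp α h₁₂ ((𝓕.toFun g₃).obj x) =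
    connectingApp α h' x ≫ (𝓕.toFun g₁).map (connectingApp α h₂₃ x) := by
  subst h₁₂ h₂₃ h
  have e := scalar_sectionOfAut (𝒴₁ := 𝒴) (𝒴₂ := 𝒴) hX (difference α g₁ g₂ g₃) x
  rw [connectingApp_rfl, connectingApp_rfl, connectingApp_rfl]
  change scalar hX 𝒴 (sectionOfAut hX (difference α g₁ g₂ g₃)) _ ≫ _ = _
  rw [e]
  have e' : (difference α g₁ g₂ g₃).hom ≫
      (α (g₁ * g₂) g₃ ≪≫ whiskerLeftIso (𝓕.toFun g₃) (α g₁ g₂)).hom =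
      (eqToIso (congrArg 𝓕.toFun (mul_assoc g₁ g₂ g₃)) ≪≫ α g₁ (g₂ * g₃) ≪≫
        whiskerRightIso (α g₂ g₃) (𝓕.toFun g₁)).hom :=
    trans_symm_hom_comp _ _
  refine (congrArg (fun δ : BasedNatTrans (𝓕.toFun (g₁ * g₂ * g₃))
    (((𝓕.toFun g₃).comp (𝓕.toFun g₂)).comp (𝓕.toFun g₁)) => δ.toNatTrans.app x) e').trans ?_
  -- The associativity isomorphism in `difference` becomes the `eqToHom` built into `connectingApp α
  -- h'`.
  have e'' := eqToIso_hom_app (congrArg 𝓕.toFun (mul_assoc g₁ g₂ g₃)) x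
  refine (congrArg (· ≫ (α g₁ (g₂ * g₃)).hom.toNatTrans.app x ≫
    (𝓕.toFun g₁).map ((α g₂ g₃).hom.toNatTrans.app x)) e'').trans ?_
  exact (Category.assoc _ _ _).symm

/-- The source of the twisted terms, in which `g₁` acts on the value of a cochain. -/
theorem toFun_map_scalar (g : G) (a : A.obj.obj (op X)) (z : 𝒴.obj) :
    (𝓕.toFun g).map (scalar hX 𝒴 a z) =
      scalar hX 𝒴 (𝓕.representation X g a) ((𝓕.toFun g).obj z) :=
  map_scalar (𝒴₁ := 𝒴) (𝒴₂ := 𝒴) hX (𝓕.toFun g) a z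

theorem obstructionCochain_cocycle (α : 𝓕.Connecting) (g₁ g₂ g₃ g₄ : G) :
    𝓕.representation X g₁ (obstructionCochain hX α ![g₂, g₃, g₄]) +
        obstructionCochain hX α ![g₁, g₂ * g₃, g₄] + obstructionCochain hX α ![g₁, g₂, g₃] =
      obstructionCochain hX α ![g₁ * g₂, g₃, g₄] +
        obstructionCochain hX α ![g₁, g₂, g₃ * g₄] := by
  refine scalar_injective hX (𝓕.toFun (g₁ * g₂ * g₃ * g₄)) fun x => ?_
  have i₁ := isIso_connectingApp α (rfl : g₁ * g₂ * g₃ * g₄ = g₁ * g₂ * g₃ * g₄) x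
  have i₂ := isIso_connectingApp α (rfl : g₁ * g₂ * g₃ = g₁ * g₂ * g₃) ((𝓕.toFun g₄).obj x)
  have i₃ := isIso_connectingApp α (rfl : g₁ * g₂ = g₁ * g₂)
    ((𝓕.toFun g₃).obj ((𝓕.toFun g₄).obj x))
  -- After composition with the isomorphism of the leftmost bracketing, `l` and `r` transform both
  -- sides into the path of the rightmost bracketing. `l` uses three instances of the defining
  -- equation, one of them under `F_{g₁}`; `r` uses the other two and the naturality square `n`.
  rw [← cancel_mono (connectingApp α rfl x ≫ connectingApp α rfl ((𝓕.toFun g₄).obj x) ≫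
    connectingApp α rfl ((𝓕.toFun g₃).obj ((𝓕.toFun g₄).obj x)))]
  have e₁ := scalar_obstructionCochain hX α (g₁ := g₁) (g₂ := g₂) (g₃ := g₃) rfl rfl rfl
    (mul_assoc _ _ _) ((𝓕.toFun g₄).obj x)
  have e₂ := scalar_obstructionCochain hX α (g₁ := g₁) (g₂ := g₂ * g₃) (g₃ := g₄)
    (mul_assoc _ _ _) (mul_assoc _ _ _).symm rfl (by simp only [mul_assoc]) x
  have e₃ := congrArg (𝓕.toFun g₁).map
    (scalar_obstructionCochain hX α (g₁ := g₂) (g₂ := g₃) (g₃ := g₄) rfl rfl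
    (mul_assoc _ _ _).symm rfl x)
  have e₄ := scalar_obstructionCochain hX α (g₁ := g₁ * g₂) (g₂ := g₃) (g₃ := g₄) rfl rfl rfl
    (mul_assoc _ _ _) x
  have e₅ := scalar_obstructionCochain hX α (g₁ := g₁) (g₂ := g₂) (g₃ := g₃ * g₄) rfl rfl
    (mul_assoc _ _ _) (by simp only [mul_assoc]) x
  have n := connectingApp_naturality α (rfl : g₁ * g₂ = g₁ * g₂)
    (connectingApp α (rfl : g₃ * g₄ = g₃ * g₄) x)
  rw [Functor.map_comp, Functor.map_comp, Functor.map_comp, toFun_map_scalar] at e₃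
  have l : scalar hX 𝒴 (𝓕.representation X g₁ (obstructionCochain hX α ![g₂, g₃, g₄]) +
        obstructionCochain hX α ![g₁, g₂ * g₃, g₄] + obstructionCochain hX α ![g₁, g₂, g₃])
        ((𝓕.toFun (g₁ * g₂ * g₃ * g₄)).obj x) ≫ connectingApp α rfl x ≫
        connectingApp α rfl ((𝓕.toFun g₄).obj x) ≫
        connectingApp α rfl ((𝓕.toFun g₃).obj ((𝓕.toFun g₄).obj x)) =
      connectingApp α (by simp only [mul_assoc]) x ≫
        (𝓕.toFun g₁).map (connectingApp α (rfl : g₂ * (g₃ * g₄) = _) x) ≫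
        (𝓕.toFun g₁).map ((𝓕.toFun g₂).map (connectingApp α rfl x)) := by
    rw [scalar_add, scalar_add, Category.assoc, Category.assoc,
      scalar_naturality_assoc hX _ (connectingApp α rfl x), e₁, reassoc_of% e₂,
      scalar_naturality_assoc]
    exact whisker_eq _ e₃
  have r : scalar hX 𝒴 (obstructionCochain hX α ![g₁ * g₂, g₃, g₄] +
        obstructionCochain hX α ![g₁, g₂, g₃ * g₄])
        ((𝓕.toFun (g₁ * g₂ * g₃ * g₄)).obj x) ≫ connectingApp α rfl x ≫
        connectingApp α rfl ((𝓕.toFun g₄).obj x) ≫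
        connectingApp α rfl ((𝓕.toFun g₃).obj ((𝓕.toFun g₄).obj x)) =
      connectingApp α (by simp only [mul_assoc]) x ≫
        (𝓕.toFun g₁).map (connectingApp α (rfl : g₂ * (g₃ * g₄) = _) x) ≫
        (𝓕.toFun g₁).map ((𝓕.toFun g₂).map (connectingApp α rfl x)) := by
    rw [add_comm, scalar_add, Category.assoc, reassoc_of% e₄, n, reassoc_of% e₅]
  exact l.trans r.symm

end GerbeAction

end Cocycle

/-! ### The coboundary relating the two obstruction cochains -/

section Comparison

variable {C : Type u} [Category.{v} C] {J : GrothendieckTopology C}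
  {A₁ A₂ : Sheaf J AddCommGrpCat.{w}} {X : C} (hX : Limits.IsTerminal X)
  {G : Type w} [Group G]
  {𝒴₁ : BandedGerbe.{w, v, u, v₁, u₁} A₁} {𝒴₂ : BandedGerbe.{w, v, u, v₂, u₂} A₂}
  {𝓕₁ : GerbeAction G 𝒴₁} {𝓕₂ : GerbeAction G 𝒴₂}
  {F : 𝒴₁.toBasedCategory ⥤ᵇ 𝒴₂.toBasedCategory}

open GerbeAction

/-- The component at `x` of a 2-isomorphism `F ∘ F¹_g ≅ F²_g ∘ F`. -/
def intertwinerApp (e : ∀ g : G, (𝓕₁.toFun g).comp F ≅ F.comp (𝓕₂.toFun g)) (g : G)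
    (x : 𝒴₁.obj) : F.obj ((𝓕₁.toFun g).obj x) ⟶ (𝓕₂.toFun g).obj (F.obj x) :=
  (e g).hom.toNatTrans.app x

theorem intertwinerApp_naturality (e : ∀ g : G, (𝓕₁.toFun g).comp F ≅ F.comp (𝓕₂.toFun g))
    (g : G) {x y : 𝒴₁.obj} (φ : x ⟶ y) :
    F.map ((𝓕₁.toFun g).map φ) ≫ intertwinerApp e g y =
      intertwinerApp e g x ≫ (𝓕₂.toFun g).map (F.map φ) :=
  (e g).hom.toNatTrans.naturality φ

theorem isIso_intertwinerApp (e : ∀ g : G, (𝓕₁.toFun g).comp F ≅ F.comp (𝓕₂.toFun g)) (g : G)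
    (x : 𝒴₁.obj) : IsIso (intertwinerApp e g x) :=
  (((BasedNatTrans.forgetful _ _).mapIso (e g)).app x).isIso_hom

/-- The 2-cochain that measures how far a family of 2-isomorphisms `F ∘ F¹_g ≅ F²_g ∘ F` is from
being compatible with the connecting 2-morphisms. -/
theorem exists_comparisonCochain
    (e : ∀ g : G, (𝓕₁.toFun g).comp F ≅ F.comp (𝓕₂.toFun g))
    (α₁ : 𝓕₁.Connecting) (α₂ : 𝓕₂.Connecting) :
    ∃ c : G → G → A₂.obj.obj (op X), ∀ {g h k : G} (hk : k = g * h) (x : 𝒴₁.obj),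
      scalar hX 𝒴₂ (c g h) (F.obj ((𝓕₁.toFun k).obj x)) ≫ intertwinerApp e k x ≫
          connectingApp α₂ hk (F.obj x) =
        F.map (connectingApp α₁ hk x) ≫ intertwinerApp e g ((𝓕₁.toFun h).obj x) ≫
          (𝓕₂.toFun g).map (intertwinerApp e h x) := by
  choose c hc using fun g h : G => exists_scalar hX (𝒴₁ := 𝒴₁) (𝒴₂ := 𝒴₂)
    (e (g * h) ≪≫ whiskerLeftIso F (α₂ g h))
    (whiskerRightIso (α₁ g h) F ≪≫ whiskerLeftIso (𝓕₁.toFun h) (e g) ≪≫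
      whiskerRightIso (e h) (𝓕₂.toFun g))
  refine ⟨c, fun {g h k} hk x => ?_⟩
  subst hk
  rw [connectingApp_rfl, connectingApp_rfl]
  exact hc g h x

theorem obstructionCochain_comparison
    {e : ∀ g : G, (𝓕₁.toFun g).comp F ≅ F.comp (𝓕₂.toFun g)}
    {α₁ : 𝓕₁.Connecting} {α₂ : 𝓕₂.Connecting} {c : G → G → A₂.obj.obj (op X)}
    (hc : ∀ {g h k : G} (hk : k = g * h) (x : 𝒴₁.obj),
      scalar hX 𝒴₂ (c g h) (F.obj ((𝓕₁.toFun k).obj x)) ≫ intertwinerApp e k x ≫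
          connectingApp α₂ hk (F.obj x) =
        F.map (connectingApp α₁ hk x) ≫ intertwinerApp e g ((𝓕₁.toFun h).obj x) ≫
          (𝓕₂.toFun g).map (intertwinerApp e h x)) (g₁ g₂ g₃ : G) :
    (bandMap F).hom.app (op X) (obstructionCochain hX α₁ ![g₁, g₂, g₃]) + c g₁ g₂ +
        c (g₁ * g₂) g₃ =
      𝓕₂.representation X g₁ (c g₂ g₃) + c g₁ (g₂ * g₃) +
        obstructionCochain hX α₂ ![g₁, g₂, g₃] := by
  refine scalar_injective hX (𝒴₁ := 𝒴₁) ((𝓕₁.toFun (g₁ * g₂ * g₃)).comp F) fun x => ?_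
  change scalar hX 𝒴₂ _ (F.obj ((𝓕₁.toFun (g₁ * g₂ * g₃)).obj x)) =
    scalar hX 𝒴₂ _ (F.obj ((𝓕₁.toFun (g₁ * g₂ * g₃)).obj x))
  have i₁ := isIso_intertwinerApp e (g₁ * g₂ * g₃) x
  have i₂ := isIso_connectingApp α₂ (rfl : g₁ * g₂ * g₃ = g₁ * g₂ * g₃) (F.obj x)
  have i₃ := isIso_connectingApp α₂ (rfl : g₁ * g₂ = g₁ * g₂) ((𝓕₂.toFun g₃).obj (F.obj x))
  -- The path that intertwines first and then splits the product in `𝒴₂` is compared with the one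
  -- that splits in `𝒴₁` and then intertwines factor by factor. `l` reaches the latter through the
  -- bracketing `(g₁g₂)g₃`, with `κ¹` arising in `𝒴₁`; `r` goes through `g₁(g₂g₃)`, with `κ²`
  -- arising in `𝒴₂`.
  rw [← cancel_mono (intertwinerApp e (g₁ * g₂ * g₃) x ≫ connectingApp α₂ rfl (F.obj x) ≫
    connectingApp α₂ rfl ((𝓕₂.toFun g₃).obj (F.obj x)))]
  have k₁ := congrArg F.map (scalar_obstructionCochain hX α₁ (g₁ := g₁) (g₂ := g₂) (g₃ := g₃)
    rfl rfl rfl (mul_assoc _ _ _) x)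
  rw [Functor.map_comp, Functor.map_comp, Functor.map_comp, map_scalar] at k₁
  have k₂ := scalar_obstructionCochain hX α₂ (g₁ := g₁) (g₂ := g₂) (g₃ := g₃)
    rfl rfl rfl (mul_assoc _ _ _) (F.obj x)
  have c₁₂ := hc (rfl : g₁ * g₂ = g₁ * g₂) ((𝓕₁.toFun g₃).obj x)
  have c₂₃ := congrArg (𝓕₂.toFun g₁).map (hc (rfl : g₂ * g₃ = g₂ * g₃) x)
  rw [Functor.map_comp, Functor.map_comp, Functor.map_comp, Functor.map_comp,
    toFun_map_scalar] at c₂₃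
  have c₁₂₃ := hc (rfl : g₁ * g₂ * g₃ = g₁ * g₂ * g₃) x
  have c₁₂₃' := hc (mul_assoc g₁ g₂ g₃) x
  have n₁ := connectingApp_naturality α₂ (rfl : g₁ * g₂ = g₁ * g₂) (intertwinerApp e g₃ x)
  have n₂ := intertwinerApp_naturality e g₁ (connectingApp α₁ (rfl : g₂ * g₃ = _) x)
  have l : scalar hX 𝒴₂ ((bandMap F).hom.app (op X) (obstructionCochain hX α₁ ![g₁, g₂, g₃]) +
        c g₁ g₂ + c (g₁ * g₂) g₃) (F.obj ((𝓕₁.toFun (g₁ * g₂ * g₃)).obj x)) ≫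
        intertwinerApp e (g₁ * g₂ * g₃) x ≫ connectingApp α₂ rfl (F.obj x) ≫
        connectingApp α₂ rfl ((𝓕₂.toFun g₃).obj (F.obj x)) =
      F.map (connectingApp α₁ (mul_assoc g₁ g₂ g₃) x) ≫
        F.map ((𝓕₁.toFun g₁).map (connectingApp α₁ rfl x)) ≫
        intertwinerApp e g₁ ((𝓕₁.toFun g₂).obj ((𝓕₁.toFun g₃).obj x)) ≫
        (𝓕₂.toFun g₁).map (intertwinerApp e g₂ ((𝓕₁.toFun g₃).obj x)) ≫
        (𝓕₂.toFun g₁).map ((𝓕₂.toFun g₂).map (intertwinerApp e g₃ x)) := by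
    rw [scalar_add, scalar_add, Category.assoc, Category.assoc, reassoc_of% c₁₂₃, n₁,
      scalar_naturality_assoc hX _ (F.map (connectingApp α₁ rfl x)), reassoc_of% c₁₂,
      reassoc_of% k₁]
  have r : scalar hX 𝒴₂ (𝓕₂.representation X g₁ (c g₂ g₃) + c g₁ (g₂ * g₃) +
        obstructionCochain hX α₂ ![g₁, g₂, g₃]) (F.obj ((𝓕₁.toFun (g₁ * g₂ * g₃)).obj x)) ≫
        intertwinerApp e (g₁ * g₂ * g₃) x ≫ connectingApp α₂ rfl (F.obj x) ≫
        connectingApp α₂ rfl ((𝓕₂.toFun g₃).obj (F.obj x)) =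
      F.map (connectingApp α₁ (mul_assoc g₁ g₂ g₃) x) ≫
        F.map ((𝓕₁.toFun g₁).map (connectingApp α₁ rfl x)) ≫
        intertwinerApp e g₁ ((𝓕₁.toFun g₂).obj ((𝓕₁.toFun g₃).obj x)) ≫
        (𝓕₂.toFun g₁).map (intertwinerApp e g₂ ((𝓕₁.toFun g₃).obj x)) ≫
        (𝓕₂.toFun g₁).map ((𝓕₂.toFun g₂).map (intertwinerApp e g₃ x)) := by
    rw [scalar_add, scalar_add, Category.assoc, Category.assoc,
      scalar_naturality_assoc hX _ (intertwinerApp e (g₁ * g₂ * g₃) x), k₂, reassoc_of% c₁₂₃',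
      scalar_naturality_assoc hX _ (F.map (connectingApp α₁ (mul_assoc g₁ g₂ g₃) x)),
      scalar_naturality_assoc, reassoc_of% n₂]
    exact whisker_eq _ (whisker_eq _ c₂₃)
  exact l.trans r.symm

end Comparison

/-! ### Explicit differentials and equality of cohomology classes -/

section Cohomology

variable {k G : Type w} [CommRing k] [Group G]

theorem d_three_apply (A : Rep.{w} k G) (f : (Fin 3 → G) → A) (g : Fin 4 → G) :
    (inhomogeneousCochains.d A 3 f : (Fin 4 → G) → A) g =
      A.ρ (g 0) (f ![g 1, g 2, g 3]) - f ![g 0 * g 1, g 2, g 3] + f ![g 0, g 1 * g 2, g 3] -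
        f ![g 0, g 1, g 2 * g 3] + f ![g 0, g 1, g 2] := by
  have h₀ : (fun i : Fin 3 => g i.succ) = ![g 1, g 2, g 3] := by
    ext i; fin_cases i <;> rfl
  have h₁ : Fin.contractNth (0 : Fin 4) (· * ·) g = ![g 0 * g 1, g 2, g 3] := by
    ext i; fin_cases i <;> rfl
  have h₂ : Fin.contractNth (1 : Fin 4) (· * ·) g = ![g 0, g 1 * g 2, g 3] := by
    ext i; fin_cases i <;> rfl
  have h₃ : Fin.contractNth (2 : Fin 4) (· * ·) g = ![g 0, g 1, g 2 * g 3] := by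
    ext i; fin_cases i <;> rfl
  -- At the last index `Fin.contractNth` drops the last entry, which gives the final term of the
  -- differential.
  have h₄ : Fin.contractNth (3 : Fin 4) (· * ·) g = ![g 0, g 1, g 2] := by
    ext i; fin_cases i <;> rfl
  rw [inhomogeneousCochains.d_hom_apply, Fin.sum_univ_four, h₀, h₁, h₂, h₃, h₄]
  simp [pow_succ]
  abel

theorem d_two_apply (A : Rep.{w} k G) (f : (Fin 2 → G) → A) (g : Fin 3 → G) :
    (inhomogeneousCochains.d A 2 f : (Fin 3 → G) → A) g =
      A.ρ (g 0) (f ![g 1, g 2]) - f ![g 0 * g 1, g 2] + f ![g 0, g 1 * g 2] -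
        f ![g 0, g 1] := by
  have h₀ : (fun i : Fin 2 => g i.succ) = ![g 1, g 2] := by
    ext i; fin_cases i <;> rfl
  have h₁ : Fin.contractNth (0 : Fin 3) (· * ·) g = ![g 0 * g 1, g 2] := by
    ext i; fin_cases i <;> rfl
  have h₂ : Fin.contractNth (1 : Fin 3) (· * ·) g = ![g 0, g 1 * g 2] := by
    ext i; fin_cases i <;> rfl
  have h₃ : Fin.contractNth (2 : Fin 3) (· * ·) g = ![g 0, g 1] := by
    ext i; fin_cases i <;> rfl
  rw [inhomogeneousCochains.d_hom_apply, Fin.sum_univ_three, h₀, h₁, h₂, h₃]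
  simp [pow_succ]
  abel

/-- If the image of a cocycle `f` differs from a cocycle `f'` by the coboundary of a cochain `c`,
then the class of `f` is mapped to the class of `f'`. -/
theorem functor_map_π_cocyclesMk {A B : Rep.{w} k G} (φ : A ⟶ B) {n : ℕ}
    (f : (Fin (n + 1) → G) → A) (f' : (Fin (n + 1) → G) → B) (c : (Fin n → G) → B)
    (h : inhomogeneousCochains.d A (n + 1) f = 0) (h' : inhomogeneousCochains.d B (n + 1) f' = 0)
    (hc : ∀ g, φ.hom (f g) = f' g + (inhomogeneousCochains.d B n c : (Fin (n + 1) → G) → B) g) :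
    (groupCohomology.functor k G (n + 1)).map φ
        (groupCohomology.π A (n + 1) (groupCohomology.cocyclesMk f h)) =
      groupCohomology.π B (n + 1) (groupCohomology.cocyclesMk f' h') := by
  have e₁ : (groupCohomology.functor k G (n + 1)).map φ
        (groupCohomology.π A (n + 1) (groupCohomology.cocyclesMk f h)) =
      groupCohomology.π B (n + 1) (groupCohomology.cocyclesMap (MonoidHom.id G) φ (n + 1)
        (groupCohomology.cocyclesMk f h)) :=
    ConcreteCategory.congr_hom (groupCohomology.π_map (MonoidHom.id G) φ (n + 1)) _
  have e₂ : groupCohomology.cocyclesMap (MonoidHom.id G) φ (n + 1)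
      (groupCohomology.cocyclesMk f h) =
      groupCohomology.cocyclesMk f' h' + groupCohomology.toCocycles B n (n + 1) c := by
    -- Cocycles embed into cochains, where the equation is `hc` pointwise.
    apply (ModuleCat.mono_iff_injective (groupCohomology.iCocycles B (n + 1))).1 inferInstance
    rw [map_add, groupCohomology.iCocycles_mk]
    have e₃ := ConcreteCategory.congr_hom (HomologicalComplex.cyclesMap_i
      (groupCohomology.cochainsMap (MonoidHom.id G) φ) (n + 1)) (groupCohomology.cocyclesMk f h)
    have e₄ := ConcreteCategory.congr_hom (HomologicalComplex.toCycles_i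
      (groupCohomology.inhomogeneousCochains B) n (n + 1)) c
    rw [groupCohomology.inhomogeneousCochains.d_def] at e₄
    refine e₃.trans ((congrArg ((groupCohomology.cochainsMap (MonoidHom.id G) φ).f (n + 1))
      (groupCohomology.iCocycles_mk f h)).trans ?_)
    refine Eq.trans ?_ (congrArg (f' + ·) e₄).symm
    exact funext hc
  have e₅ : groupCohomology.π B (n + 1) (groupCohomology.toCocycles B n (n + 1) c) = 0 :=
    ConcreteCategory.congr_hom (HomologicalComplex.toCycles_comp_homologyπ
      (groupCohomology.inhomogeneousCochains B) n (n + 1)) c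
  rw [e₁, e₂, map_add, e₅, add_zero]

end Cohomology

/-! ### Equality of the obstruction classes -/

section Main

variable {C : Type u} [Category.{v} C] {J : GrothendieckTopology C}
  {X : C} (hX : Limits.IsTerminal X) {G : Type w} [Group G]

open GerbeAction

theorem GerbeAction.d_obstructionCochain {A : Sheaf J AddCommGrpCat.{w}}
    {𝒴 : BandedGerbe.{w, v, u, v₁, u₁} A} {𝓕 : GerbeAction G 𝒴} (α : 𝓕.Connecting) :
    inhomogeneousCochains.d (𝓕.rep X) 3 (obstructionCochain hX α) = 0 := by
  funext g
  rw [d_three_apply]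
  have h := obstructionCochain_cocycle hX α (g 0) (g 1) (g 2) (g 3)
  -- The rearrangement is made in an abstract group; unification then identifies the carrier of
  -- `𝓕.rep X` with `A(X)`.
  have h' : ∀ {M : Type w} [AddCommGroup M] {a b c d e : M}, a + b + c = d + e →
      a - d + b - e + c = 0 := by
    intro M _ a b c d e h
    rw [← sub_eq_zero.2 h]
    abel
  exact h' h

variable {A₁ A₂ : Sheaf J AddCommGrpCat.{w}}
  {𝒴₁ : BandedGerbe.{w, v, u, v₁, u₁} A₁} {𝒴₂ : BandedGerbe.{w, v, u, v₂, u₂} A₂}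
  {𝓕₁ : GerbeAction G 𝒴₁} {𝓕₂ : GerbeAction G 𝒴₂}
  {F : 𝒴₁.toBasedCategory ⥤ᵇ 𝒴₂.toBasedCategory}

theorem IsEquivariant.map_obstructionClass (hF : IsEquivariant 𝓕₁ 𝓕₂ F)
    (α₁ : 𝓕₁.Connecting) (α₂ : 𝓕₂.Connecting) :
    (groupCohomology.functor (ULift.{w} ℤ) G 3).map (hF.repHom X)
        (obstructionClass hX α₁ (d_obstructionCochain hX α₁)) =
      obstructionClass hX α₂ (d_obstructionCochain hX α₂) := by
  obtain ⟨c, hc⟩ := exists_comparisonCochain hX (fun g => (hF g).some) α₁ α₂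
  refine functor_map_π_cocyclesMk (hF.repHom X) _ _ (fun g => c (g 0) (g 1)) _ _ fun g => ?_
  rw [d_two_apply]
  have h := obstructionCochain_comparison hX hc (g 0) (g 1) (g 2)
  have h' : ∀ {M : Type w} [AddCommGroup M] {a b c d e f : M}, a + b + c = d + e + f →
      a = f + (d - c + e - b) := by
    intro M _ a b c d e f h
    rw [← sub_eq_zero] at h ⊢
    rw [← h]
    abel
  have h₃ : ![g 0, g 1, g 2] = g := by
    ext i; fin_cases i <;> rfl
  rw [h₃] at h
  exact h' h

theorem bandMap_id :
    bandMap (𝒴₁ := 𝒴₁) (𝒴₂ := 𝒴₁) (BasedFunctor.id 𝒴₁.toBasedCategory) = 𝟙 A₁ :=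
  IsBandMap.bandMap_eq fun _ _ _ => rfl

/-- The equality `hρ` of representations on a fixed module can be substituted, unlike the equality
`h` of bundled objects. -/
theorem eqToHom_rep_hom_apply {k : Type w} [CommRing k] {V : Type w} [AddCommGroup V] [Module k V]
    {ρ ρ' : Representation k G V} (hρ : ρ = ρ') (h : Rep.of ρ = Rep.of ρ') (a : V) :
    (eqToHom h).hom a = a := by
  subst hρ
  rfl

end Main

end TorsorsAndGerbes

open TorsorsAndGerbes

theorem proposition4p18 {C : Type u} [Category.{v} C] (J : GrothendieckTopology C)
    {X : C} (hX : Limits.IsTerminal X) {G : Type w} [Group G] [Finite G]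
    {A₁ : Sheaf J AddCommGrpCat.{w}} (𝒴₁ : TorsorsAndGerbes.BandedGerbe.{w, v, u, v₁, u₁} A₁)
    (𝓕₁ : TorsorsAndGerbes.GerbeAction G 𝒴₁) :
    (∀ {A₂ : Sheaf J AddCommGrpCat.{w}} (𝒴₂ : TorsorsAndGerbes.BandedGerbe.{w, v, u, v₂, u₂} A₂)
      (𝓕₂ : TorsorsAndGerbes.GerbeAction G 𝒴₂)
      (F : 𝒴₁.toBasedCategory ⥤ᵇ 𝒴₂.toBasedCategory)
      (hF : TorsorsAndGerbes.IsEquivariant 𝓕₁ 𝓕₂ F)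
      (α₁ : 𝓕₁.Connecting) (α₂ : 𝓕₂.Connecting),
      ∃ (h₁ : inhomogeneousCochains.d (𝓕₁.rep X) 3
            (TorsorsAndGerbes.GerbeAction.obstructionCochain hX α₁) = 0)
        (h₂ : inhomogeneousCochains.d (𝓕₂.rep X) 3
            (TorsorsAndGerbes.GerbeAction.obstructionCochain hX α₂) = 0),
        TorsorsAndGerbes.GerbeAction.obstructionClass hX α₂ h₂ =
          (groupCohomology.functor (ULift.{w} ℤ) G 3).map (hF.repHom X)
            (TorsorsAndGerbes.GerbeAction.obstructionClass hX α₁ h₁)) ∧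
    (∀ 𝓕₁' : TorsorsAndGerbes.GerbeAction G 𝒴₁,
      (∀ g : G, Nonempty (𝓕₁.toFun g ≅ 𝓕₁'.toFun g)) →
      (∀ g : G, TorsorsAndGerbes.bandMap (𝒴₁ := 𝒴₁) (𝒴₂ := 𝒴₁) (𝓕₁.toFun g) =
        TorsorsAndGerbes.bandMap (𝒴₁ := 𝒴₁) (𝒴₂ := 𝒴₁) (𝓕₁'.toFun g)) ∧
      ∃ hrep : 𝓕₁.rep X = 𝓕₁'.rep X, ∀ (α : 𝓕₁.Connecting) (α' : 𝓕₁'.Connecting),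
        ∃ (h : inhomogeneousCochains.d (𝓕₁.rep X) 3
              (TorsorsAndGerbes.GerbeAction.obstructionCochain hX α) = 0)
          (h' : inhomogeneousCochains.d (𝓕₁'.rep X) 3
              (TorsorsAndGerbes.GerbeAction.obstructionCochain hX α') = 0),
          TorsorsAndGerbes.GerbeAction.obstructionClass hX α' h' =
            (groupCohomology.functor (ULift.{w} ℤ) G 3).map (eqToHom hrep)
              (TorsorsAndGerbes.GerbeAction.obstructionClass hX α h)) := by
  refine ⟨fun 𝒴₂ 𝓕₂ F hF α₁ α₂ => ⟨GerbeAction.d_obstructionCochain hX α₁,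
    GerbeAction.d_obstructionCochain hX α₂, (hF.map_obstructionClass hX α₁ α₂).symm⟩,
    fun 𝓕₁' e => ?_⟩
  have hband : ∀ g : G, bandMap (𝒴₁ := 𝒴₁) (𝒴₂ := 𝒴₁) (𝓕₁.toFun g) =
      bandMap (𝒴₁ := 𝒴₁) (𝒴₂ := 𝒴₁) (𝓕₁'.toFun g) := fun g => bandMap_congr (e g).some
  have hρ : 𝓕₁.representation X = 𝓕₁'.representation X := by
    ext g a
    exact congrArg (fun δ : A₁ ⟶ A₁ => δ.hom.app (op X) a) (hband g)
  have hrep : 𝓕₁.rep X = 𝓕₁'.rep X := congrArg Rep.of hρ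
  refine ⟨hband, hrep, fun α α' => ⟨GerbeAction.d_obstructionCochain hX α,
    GerbeAction.d_obstructionCochain hX α', ?_⟩⟩
  -- Composition with the identity functor is definitionally trivial, so `e` itself witnesses the
  -- equivariance.
  have hF : IsEquivariant 𝓕₁ 𝓕₁' (BasedFunctor.id 𝒴₁.toBasedCategory) := e
  have hhom : eqToHom hrep = hF.repHom X := by
    ext a
    refine (eqToHom_rep_hom_apply hρ hrep a).trans ?_
    exact (congrArg (fun δ : A₁ ⟶ A₁ => δ.hom.app (op X) a) bandMap_id).symm
  rw [hhom]
  exact (hF.map_obstructionClass hX α α').symm
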